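/- **Conventions.** A weak composition $\gamma=(\gamma_1,\gamma_2,\dots)$ is a sequence of nonnegative integers with finitely many nonzero parts (so trailing zeros are disregarded), and $\lambda(\gamma)$ is the partition with the same nonzero parts. The skyline diagram of $\gamma$ has $\gamma_i$ left-justified boxes in row $i$, rows being numbered from top to bottom; with basement $b_i=i$ it has in addition a column $0$ with the value $i$ in row $i$. A set-valued filling assigns a non-empty finite set of positive integers to each box; the largest entry of a box is its *anchor* entry, the others are *free*. A box $(i,k)$ *can host* $\alpha$ if $\alpha$ is smaller than its anchor entry (so that $\alpha$ would be free there) and row $i$ (including the basement) is still weakly decreasing after $\alpha$ is added to the box; here sets satisfy $A\ge B$ if $\min A\ge\max B$. Three boxes in rows $i<j$ form a triple $(a,b,c)$ in two cases. Type A ($\gamma_i\ge\gamma_j$): $c,a$ are the boxes of row $i$ in columns $k,k+1$, and $b$ is the box of row $j$ in column $k+1$. Type B ($\gamma_i<\gamma_j$): $c,a$ are the boxes of row $j$ in columns $k,k+1$, and $b$ is the box of row $i$ in column $k$. A triple is an *inversion triple* if its anchor entries satisfy $b>c\ge a$ or $c\ge a>b$. $\mathsf{SetSkyFill}(\gamma)$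 is the set of semistandard set-valued fillings of the skyline diagram of $\gamma$ with basement $b_i=i$: (S1) entries do not repeat in a column; (S2) rows, including the basement, are weakly decreasing; (S3) every triple of anchor entries, including those with basement boxes, is an inversion triple; (S4) every free entry is in the highest row of its column that can host it. $\mathsf{SetRT}(\lambda)$ is the set of fillings of the Young diagram of $\lambda$ with non-empty finite sets of positive integers whose rows are weakly decreasing and whose columns are strictly decreasing ($A>B$ if $\min A>\max B$). *The map $\hat\rho$.* Given $F$, sort the anchor entries of each column into decreasing order; then put each free entry $\alpha$ of the column into the box whose anchor is larger than $\alpha$ while the anchor of the box below it (if any) is smaller than $\alpha$. *The map $\hat\rho^{-1}$.* Given $T$, start with the empty skyline diagram with basement $b_i=i$. Take the anchor entries of $T$ column by column from left to right, each column from top to bottom, and place each in the same column of the new diagram, in the first row whose position in this column is empty and whose left neighbour is present and at least as large. When all anchor entries have been placed, put each free entry of a column into the highest box of this column that can host it. **Theorem.** Let $\lambda$ be a partition. Then $\hat\rho$ is a bijection $$\hat\rho:\bigcup_{\gamma:\ \lambda(\gamma)=\lambda}\mathsf{SetSkyFill}(\gamma)\longrightarrow \mathsf{SetRT}(\lambda),$$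 and $\hat\rho^{-1}$ is a bijection in the opposite direction; the two maps are mutually inverse. Moreover both maps preserve, in each column, the anchor entries and the free entries: for $F$ in the domain, the anchor entries of a column of $\hat\rho(F)$, read from top to bottom, are those of the same column of $F$ sorted into decreasing order, and the two columns have the same free entries; for $T\in\mathsf{SetRT}(\lambda)$, each column of $\hat\rho^{-1}(T)$ has the same anchor entries (up to order) and the same free entries as that column of $T$. -/

import Mathlib

namespace SetSkyline

/-- A set-valued filling of some diagram: `F r c` is the set of entries in the box in row `r` and
column `c`. Boxes outside the diagram carry the empty set. Rows are numbered `0, 1, 2, …` from top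
to bottom and columns `0, 1, 2, …` from left to right; the basement is not part of the data. -/
abbrev SetFilling : Type := ℕ → ℕ → Finset ℕ

/-- All entries are positive integers. -/
def PosEntries (F : SetFilling) : Prop := ∀ r c, ∀ x ∈ F r c, 0 < x

/-- The anchor entry (largest entry) of a box; it is `0` if the box is empty. -/
def anchor (F : SetFilling) (r c : ℕ) : ℕ := (F r c).sup id

/-- The free entries of a box: all its entries except the anchor. -/
def free (F : SetFilling) (r c : ℕ) : Finset ℕ := (F r c).erase (anchor F r c)

/-- The filling with a basement `b` attached: column `0` is the basement, and column `k + 1` is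
column `k` of the filling. -/
def withBasement (b : ℕ → ℕ) (F : SetFilling) (r : ℕ) : ℕ → Finset ℕ
  | 0 => {b r}
  | k + 1 => F r k

/-- The basement `b_i = i`, with `i = r + 1` the number of row `r` when rows are counted from 1. -/
def stdBasement (r : ℕ) : ℕ := r + 1

/-! ### Semistandard set-valued skyline fillings

Weak compositions are finitely supported sequences `γ : ℕ →₀ ℕ`, that is, trailing zero parts are
disregarded. -/

/-- The boxes of `F` form the skyline diagram of `γ`: row `r` has `γ r` left-justified boxes. -/
def HasSkylineShape (F : SetFilling) (γ : ℕ →₀ ℕ) : Prop :=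
  ∀ r c, (F r c).Nonempty ↔ c < γ r

/-- No entry is repeated in a column. -/
def ColumnsDistinct (F : SetFilling) : Prop :=
  ∀ c r r', r ≠ r' → Disjoint (F r c) (F r' c)

/-- Rows, including the basement, are weakly decreasing. -/
def RowsWeaklyDecreasing (b : ℕ → ℕ) (F : SetFilling) : Prop :=
  ∀ r k, ∀ x ∈ withBasement b F r k, ∀ y ∈ withBasement b F r (k + 1), y ≤ x

/-- The condition for a triple to be an inversion triple. -/
def IsInversionTriple (a b c : ℕ) : Prop := (b > c ∧ c ≥ a) ∨ (c ≥ a ∧ a > b)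

/-- The anchor entries with the basement attached as column `0`. -/
def anchorB (b : ℕ → ℕ) (F : SetFilling) (r k : ℕ) : ℕ := (withBasement b F r k).sup id

/-- Every triple of anchor entries (including triples with basement boxes) is an inversion triple.
Rows are `i < j`; columns `k` and `k + 1` are counted with the basement as column `0`, so that row
`r` occupies the columns `0, …, γ r`.
Type A (`γ i ≥ γ j`): `c, a` are the boxes of row `i` in columns `k, k + 1` and `b` is the box of
row `j` in column `k + 1`.
Type B (`γ i < γ j`): `c, a` are the boxes of row `j` in columns `k, k + 1` and `b` is the box of
row `i` in column `k`. -/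
def TriplesInversion (b : ℕ → ℕ) (γ : ℕ →₀ ℕ) (F : SetFilling) : Prop :=
  (∀ i j k, i < j → γ j ≤ γ i → k + 1 ≤ γ j →
    IsInversionTriple (anchorB b F i (k + 1)) (anchorB b F j (k + 1)) (anchorB b F i k)) ∧
  (∀ i j k, i < j → γ i < γ j → k ≤ γ i →
    IsInversionTriple (anchorB b F j (k + 1)) (anchorB b F i k) (anchorB b F j k))

/-- The value `α` can stand as a free entry in the box `(r, c)` of `F`: it is smaller than the
anchor of that box (which therefore exists), and row `r` is still weakly decreasing when `α` is
added to the box. -/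
def CanHost (b : ℕ → ℕ) (F : SetFilling) (r c α : ℕ) : Prop :=
  α < anchor F r c ∧ (∀ x ∈ withBasement b F r c, α ≤ x) ∧ (∀ y ∈ F r (c + 1), y ≤ α)

/-- Every free entry is in the highest row of its column that can host it as a free entry. -/
def FreeEntriesHighest (b : ℕ → ℕ) (F : SetFilling) : Prop :=
  ∀ r c, ∀ α ∈ free F r c, ∀ r' < r, ¬ CanHost b F r' c α

/-- The semistandard set-valued skyline fillings of shape `γ` with basement `b_i = i`. -/
def SetSkyFill (γ : ℕ →₀ ℕ) : Set SetFilling :=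
  {F | HasSkylineShape F γ ∧ PosEntries F ∧ ColumnsDistinct F ∧
    RowsWeaklyDecreasing stdBasement F ∧ TriplesInversion stdBasement γ F ∧
    FreeEntriesHighest stdBasement F}

/-- The partition `λ(γ)` with the same (nonzero) parts as `γ`, as a Young diagram. -/
def partitionOf (γ : ℕ →₀ ℕ) : YoungDiagram :=
  YoungDiagram.ofRowLens ((γ.support.val.map γ).sort (· ≥ ·))
    (Multiset.pairwise_sort (γ.support.val.map γ) (· ≥ ·)).sortedGE

/-! ### Set-valued reverse tableaux -/

/-- The set-valued reverse tableaux of shape `μ`: rows weakly decrease, columns strictly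
decrease. -/
def SetRT (μ : YoungDiagram) : Set SetFilling :=
  {T | (∀ r c, (T r c).Nonempty ↔ (r, c) ∈ μ) ∧ PosEntries T ∧
    (∀ r c, ∀ x ∈ T r c, ∀ y ∈ T r (c + 1), y ≤ x) ∧
    (∀ r c, ∀ x ∈ T r c, ∀ y ∈ T (r + 1) c, y < x)}

/-! ### The two maps -/

open Classical in
/-- The rows that have a box in column `c`. All diagrams in question are finite; for a filling with
infinitely many boxes in column `c` the value is the junk value `∅`. -/
noncomputable def colRows (F : SetFilling) (c : ℕ) : Finset ℕ :=
  if h : {r | (F r c).Nonempty}.Finite then h.toFinset else ∅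

/-- The anchor entries of column `c`, read from top to bottom. -/
noncomputable def colAnchors (F : SetFilling) (c : ℕ) : List ℕ :=
  ((colRows F c).sort (· ≤ ·)).map fun r => anchor F r c

/-- The free entries of column `c`. -/
noncomputable def colFree (F : SetFilling) (c : ℕ) : Finset ℕ :=
  (colRows F c).biUnion fun r => free F r c

/-- The anchor entries of column `c`, sorted into decreasing order. -/
noncomputable def sortedAnchors (F : SetFilling) (c : ℕ) : List ℕ :=
  (colAnchors F c).insertionSort (· ≥ ·)

/-- The map `ρ̂`: the anchor entries of each column are sorted into decreasing order, and a free
entry `α` of the column goes to the box whose anchor is larger than `α` while the anchor of the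
next box below (if there is one) is smaller than `α`. -/
noncomputable def rhoHat (F : SetFilling) : SetFilling := fun r c =>
  if r < (sortedAnchors F c).length then
    insert ((sortedAnchors F c).getD r 0)
      ((colFree F c).filter fun α =>
        (sortedAnchors F c).getD (r + 1) 0 < α ∧ α < (sortedAnchors F c).getD r 0)
  else ∅

open Classical in
/-- Place the entry `a` into a partially filled column `col` (where `0` means that the position is
empty), to the right of the column `left`: it goes to the first row whose position is empty and
whose left neighbour is present and at least `a`. If there were no such row, nothing is placed. -/
noncomputable def placeAnchor (left col : ℕ → ℕ) (a : ℕ) : ℕ → ℕ :=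
  if h : ∃ r, col r = 0 ∧ left r ≠ 0 ∧ a ≤ left r then
    Function.update col (Nat.find h) a
  else col

/-- The columns obtained by inserting the anchor entries of `T`, column by column from left to
right and each column of `T` from top to bottom. Column `0` is the basement `b_i = i`, column
`k + 1` comes from column `k` of `T`. The value `0` means that there is no box. -/
noncomputable def insertColumn (T : SetFilling) : ℕ → (ℕ → ℕ)
  | 0 => stdBasement
  | k + 1 => (colAnchors T k).foldl (placeAnchor (insertColumn T k)) (fun _ => 0)

/-- The filling by anchor entries only that is obtained by the insertion. -/
noncomputable def insertAnchors (T : SetFilling) : SetFilling := fun r c =>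
  if insertColumn T (c + 1) r = 0 then ∅ else {insertColumn T (c + 1) r}

open Classical in
/-- The map `ρ̂⁻¹`: insert the anchor entries, then put each free entry of a column into the
highest box of that column which can host it as a free entry. (Whether a box can host `α` depends
only on anchors, not on the free entries placed before, so the order of placement is
irrelevant.) -/
noncomputable def rhoHatInv (T : SetFilling) : SetFilling := fun r c =>
  insertAnchors T r c ∪ (colFree T c).filter fun α =>
    CanHost stdBasement (insertAnchors T) r c α ∧
      ∀ r' < r, ¬ CanHost stdBasement (insertAnchors T) r' c α

end SetSkyline

/-! The point is to replace the triple condition by a local, greedy one. With `0` for an absent box,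
`IsGreedy L C` says that an entry of `C` skips a higher row with a large enough left neighbour only
if that row holds a larger entry. For fillings with decreasing rows and distinct column entries, the
triple condition holds iff each column of anchors is greedy over its left neighbour
(`TriplesInversion.isGreedy`, `TriplesInversion.of_isGreedy`). A greedy column is determined by its
left neighbour and its set of entries (`IsGreedy.foldl_placeAnchor`), so the column sets determine
all anchors. Conversely, insertion yields greedy columns whenever there is room
(`isGreedy_foldl_placeAnchor`), and the inequalities of a reverse tableau provide the room
(`insertColumn_spec`).

Free entries are governed by `anchorCount`, the number of anchors of a column exceeding `α`. With
decreasing rows, a box can host `α` iff `α` is below its anchor and at least the anchor to its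
right. Such a box exists only if the count drops strictly from the column to the next one, and with
decreasing anchor rows a drop produces such a box. Counts ignore the order of a column, so this
information passes between both kinds of filling; (S4), respectively strict decrease down columns,
then fixes the box. -/

namespace SetSkyline

/-! ### Decreasing lists -/

/-- Turns comparisons of sorted columns into comparisons of counts, which do not depend on order.
The default `0` is never above `α`, so no bound on `r` is needed. -/
theorem lt_getD_iff_lt_countP {l : List ℕ} (hl : l.Pairwise (· ≥ ·)) (α r : ℕ) :
    α < l.getD r 0 ↔ r < l.countP (α < ·) := by
  induction l generalizing r with
  | nil => simp
  | cons a l ih =>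
    rw [List.pairwise_cons] at hl
    by_cases ha : α < a
    · cases r with
      | zero => simp [ha]
      | succ r => simpa [ha] using ih hl.2 r
    · have h0 : l.countP (α < ·) = 0 := by
        rw [List.countP_eq_zero]
        intro b hb
        have := hl.1 b hb
        simp only [decide_eq_true_eq]
        omega
      cases r with
      | zero => simp [ha, h0]
      | succ r => simpa [ha, h0] using ih hl.2 r

/-! ### Greedy columns -/

/-- The column `C` arises from the column `L` to its left by inserting its entries in decreasing
order, each into the first row that is still free and has a large enough left neighbour. -/
structure IsGreedy (L C : ℕ → ℕ) : Prop where
  le : ∀ r, C r ≤ L r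
  inj : ∀ i j, C i ≠ 0 → C i = C j → i = j
  lt : ∀ i j, i < j → C j ≠ 0 → C j ≤ L i → C j < C i

/-- Uniqueness of greedy columns, by induction on the entries inserted so far: `hup` makes `l` an
upper segment of the entries of `C`, and the partial column is `C` restricted to that segment. -/
theorem IsGreedy.foldl_placeAnchor_prefix {L C : ℕ → ℕ} (h : IsGreedy L C) (l : List ℕ)
    (hl : l.Pairwise (· > ·)) (hpos : ∀ a ∈ l, a ≠ 0) (hmem : ∀ a ∈ l, ∃ r, C r = a)
    (hup : ∀ r, ∀ a ∈ l, a ≤ C r → C r ∈ l) :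
    l.foldl (placeAnchor L) (fun _ => 0) = fun r => if C r ∈ l then C r else 0 := by
  induction l using List.reverseRecOn with
  | nil => simp
  | append_singleton l a ih =>
    rw [List.pairwise_append] at hl
    have hla : ∀ b ∈ l, a < b := fun b hb => hl.2.2 b hb a (by simp)
    have hup' : ∀ r, a < C r → C r ∈ l := by
      intro r hr
      have := hup r a (by simp) hr.le
      simp only [List.mem_append, List.mem_singleton] at this
      rcases this with h | h
      · exact h
      · omega
    rw [List.foldl_append, ih hl.1 (fun b hb => hpos b (by simp [hb]))
      (fun b hb => hmem b (by simp [hb]))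
      (fun r b hb hbr => hup' r ((hla b hb).trans_le hbr))]
    obtain ⟨j, hj⟩ := hmem a (by simp)
    have ha0 : a ≠ 0 := hpos a (by simp)
    have hal : a ∉ l := fun hh => lt_irrefl _ (hla a hh)
    have hjP : (if C j ∈ l then C j else 0) = 0 ∧ L j ≠ 0 ∧ a ≤ L j := by
      have := h.le j
      refine ⟨by simp [hj, hal], by omega, by omega⟩
    have hex : ∃ r, (if C r ∈ l then C r else 0) = 0 ∧ L r ≠ 0 ∧ a ≤ L r := ⟨j, hjP⟩
    have hfind : Nat.find hex = j := by
      rw [Nat.find_eq_iff]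
      refine ⟨hjP, ?_⟩
      -- A higher row with room for `a` carries an entry of `C` larger than `a`, which has already
      -- been inserted.
      rintro i hi ⟨h1, -, h3⟩
      have h4 := h.lt i j hi (by omega) (by omega)
      have h5 := hup' i (by omega)
      rw [if_pos h5] at h1
      omega
    simp only [List.foldl_cons, List.foldl_nil, placeAnchor]
    rw [dif_pos hex, hfind]
    funext r
    by_cases hr : r = j
    · subst hr
      simp [hj]
    · have hne : C r ≠ a := fun hh => hr (h.inj r j (by omega) (by omega))
      simp [Function.update_of_ne hr, hne]

theorem IsGreedy.foldl_placeAnchor {L C : ℕ → ℕ} (h : IsGreedy L C) {l : List ℕ}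
    (hl : l.Pairwise (· > ·)) (hmem : ∀ a, a ∈ l ↔ a ≠ 0 ∧ ∃ r, C r = a) :
    l.foldl (placeAnchor L) (fun _ => 0) = C := by
  rw [h.foldl_placeAnchor_prefix l hl (fun a ha => ((hmem a).1 ha).1)
    (fun a ha => ((hmem a).1 ha).2)]
  · funext r
    by_cases hr : C r = 0
    · simp [hr]
    · rw [if_pos ((hmem _).2 ⟨hr, r, rfl⟩)]
  · intro r a ha har
    have := ((hmem a).1 ha).1
    exact (hmem _).2 ⟨by omega, r, rfl⟩

/-- `hroom` is a Hall-type condition: entry `n` has more than `n` admissible rows, and only `n` rows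
are occupied when its turn comes. The set `s` keeps track of the occupied rows for this count. -/
theorem isGreedy_foldl_placeAnchor (L : ℕ → ℕ) (l : List ℕ) (hl : l.Pairwise (· > ·))
    (hpos : ∀ a ∈ l, a ≠ 0)
    (hroom : ∀ n < l.length, ∃ s : Finset ℕ, n < s.card ∧ ∀ r ∈ s, l.getD n 0 ≤ L r) :
    IsGreedy L (l.foldl (placeAnchor L) (fun _ => 0)) ∧
      (∀ a, a ∈ l ↔ a ≠ 0 ∧ ∃ r, l.foldl (placeAnchor L) (fun _ => 0) r = a) ∧
      ∃ s : Finset ℕ, s.card = l.length ∧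
        ∀ r, r ∈ s ↔ l.foldl (placeAnchor L) (fun _ => 0) r ≠ 0 := by
  induction l using List.reverseRecOn with
  | nil =>
    refine ⟨⟨by simp, by simp, by simp⟩, ?_, ∅, by simp⟩
    simp only [List.not_mem_nil, List.foldl_nil, false_iff]
    rintro a ⟨h, _, h'⟩
    exact h h'.symm
  | append_singleton l a ih =>
    rw [List.pairwise_append] at hl
    have hla : ∀ b ∈ l, a < b := fun b hb => hl.2.2 b hb a (by simp)
    have ha0 : a ≠ 0 := hpos a (by simp)
    obtain ⟨hg, hmem, s, hs, hsr⟩ := ih hl.1 (fun b hb => hpos b (by simp [hb])) (by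
      intro n hn
      obtain ⟨s, h1, h2⟩ := hroom n (by simp; omega)
      refine ⟨s, h1, ?_⟩
      rwa [List.getD_append _ _ _ _ hn] at h2)
    obtain ⟨t, ht, htr⟩ := hroom l.length (by simp)
    rw [List.getD_append_right _ _ _ _ le_rfl] at htr
    simp only [Nat.sub_self, List.getD_cons_zero] at htr
    rw [List.foldl_append]
    set col := l.foldl (placeAnchor L) (fun _ => 0) with hcol
    have hex : ∃ r, col r = 0 ∧ L r ≠ 0 ∧ a ≤ L r := by
      obtain ⟨r, hr, hr'⟩ := Finset.exists_mem_notMem_of_card_lt_card (hs ▸ ht)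
      have h1 := htr r hr
      rw [hsr, not_not] at hr'
      exact ⟨r, hr', by omega, h1⟩
    simp only [List.foldl_cons, List.foldl_nil, placeAnchor]
    rw [dif_pos hex]
    obtain ⟨h1, h2, h3⟩ := Nat.find_spec hex
    have hmin : ∀ i < Nat.find hex, a ≤ L i → col i ≠ 0 := fun i hi hai h0 =>
      Nat.find_min hex hi ⟨h0, by omega, hai⟩
    set j := Nat.find hex with hj
    have hbig : ∀ i, col i ≠ 0 → a < col i := fun i hi => hla _ ((hmem _).2 ⟨hi, i, rfl⟩)
    have hup : ∀ i, i ≠ j → Function.update col j a i = col i := fun i hi =>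
      Function.update_of_ne hi _ _
    have hupj : Function.update col j a j = a := Function.update_self _ _ _
    refine ⟨⟨fun r => ?_, fun i k hi hik => ?_, fun i k hik hk hki => ?_⟩, fun b => ?_,
      insert j s, ?_, fun r => ?_⟩
    · by_cases hr : r = j
      · rw [hr, hupj]; exact h3
      · rw [hup r hr]; exact hg.le r
    · by_cases hij : i = j <;> by_cases hkj : k = j
      · rw [hij, hkj]
      · rw [hij, hupj, hup k hkj] at hik
        have := hbig k (by omega)
        omega
      · rw [hkj, hupj, hup i hij] at hik
        have := hbig i (by omega)
        omega
      · rw [hup i hij] at hik hi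
        rw [hup k hkj] at hik
        exact hg.inj i k hi hik
    -- For the new entry, minimality of `j` says that row `i` was occupied, hence by a larger entry.
    · by_cases hkj : k = j
      · rw [hkj, hupj] at hki ⊢
        rw [hup i (by omega)]
        exact hbig i (hmin i (by omega) hki)
      · rw [hup k hkj] at hki hk ⊢
        have h4 := hg.lt i k hik hk hki
        -- Impossible: `col j` was still `0`, and `h4` would put something below it.
        by_cases hij : i = j
        · rw [hij] at h4; omega
        · rwa [hup i hij]
    · simp only [List.mem_append, List.mem_singleton, hmem]
      constructor
      · rintro (⟨hb, r, hr⟩ | rfl)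
        · refine ⟨hb, r, ?_⟩
          rw [hup r (by rintro rfl; omega), hr]
        · exact ⟨ha0, j, hupj⟩
      · rintro ⟨hb, r, hr⟩
        by_cases hrj : r = j
        · rw [hrj, hupj] at hr; exact Or.inr hr.symm
        · rw [hup r hrj] at hr; exact Or.inl ⟨hb, r, hr⟩
    · rw [Finset.card_insert_of_notMem (by rw [hsr]; simpa using h1), hs]
      simp
    · rw [Finset.mem_insert, hsr]
      by_cases hrj : r = j
      · rw [hrj, hupj]; simp [ha0]
      · rw [hup r hrj]; simp [hrj]

/-! ### Anchors and boxes -/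

theorem le_anchor {F : SetFilling} {r c x : ℕ} (hx : x ∈ F r c) : x ≤ anchor F r c :=
  Finset.le_sup (f := id) hx

theorem anchor_mem {F : SetFilling} {r c : ℕ} (h : (F r c).Nonempty) : anchor F r c ∈ F r c := by
  obtain ⟨x, hx, hx'⟩ := Finset.exists_mem_eq_sup (F r c) h id
  rw [anchor, hx']
  exact hx

theorem mem_free {F : SetFilling} {r c x : ℕ} :
    x ∈ free F r c ↔ x ∈ F r c ∧ x < anchor F r c := by
  rw [free, Finset.mem_erase]
  exact ⟨fun h => ⟨h.2, lt_of_le_of_ne (le_anchor h.2) h.1⟩, fun h => ⟨h.2.ne, h.1⟩⟩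

theorem mem_iff_eq_anchor_or_mem_free {F : SetFilling} {r c x : ℕ} :
    x ∈ F r c ↔ ((F r c).Nonempty ∧ x = anchor F r c) ∨ x ∈ free F r c := by
  rw [mem_free]
  constructor
  · intro h
    rcases (le_anchor h).eq_or_lt with h' | h'
    · exact Or.inl ⟨⟨x, h⟩, h'⟩
    · exact Or.inr ⟨h, h'⟩
  · rintro (⟨h, rfl⟩ | h)
    · exact anchor_mem h
    · exact h.1

theorem anchor_ne_zero_iff {F : SetFilling} (hF : PosEntries F) {r c : ℕ} :
    anchor F r c ≠ 0 ↔ (F r c).Nonempty := by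
  constructor
  · intro h
    rw [Finset.nonempty_iff_ne_empty]
    intro h'
    rw [anchor, h'] at h
    exact h rfl
  · intro h
    exact (hF r c _ (anchor_mem h)).ne'

theorem anchorB_zero (b : ℕ → ℕ) (F : SetFilling) (r : ℕ) : anchorB b F r 0 = b r := by
  simp [anchorB, withBasement]

theorem anchorB_succ (b : ℕ → ℕ) (F : SetFilling) (r k : ℕ) :
    anchorB b F r (k + 1) = anchor F r k := rfl

theorem RowsWeaklyDecreasing.anchorB_le {b : ℕ → ℕ} {F : SetFilling}
    (h : RowsWeaklyDecreasing b F) {r k x : ℕ} (hx : x ∈ withBasement b F r k) :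
    anchor F r k ≤ x := Finset.sup_le fun y hy => h r k x hx y hy

theorem RowsWeaklyDecreasing.anchorB_succ_le {b : ℕ → ℕ} {F : SetFilling} {γ : ℕ →₀ ℕ}
    (h : RowsWeaklyDecreasing b F) (hF : HasSkylineShape F γ) (r k : ℕ) :
    anchorB b F r (k + 1) ≤ anchorB b F r k := by
  refine Finset.sup_le fun y hy => ?_
  cases k with
  | zero =>
    rw [anchorB_zero]
    exact h r 0 (b r) (by simp [withBasement]) y hy
  | succ k =>
    have h1 : (F r k).Nonempty := by
      have := (hF r (k + 1)).1 ⟨y, hy⟩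
      rw [hF]
      omega
    exact h r (k + 1) _ (anchor_mem h1) y hy

/-- The left neighbour imposes nothing new, since its entries already bound the anchor. Hosting
therefore depends on anchors only. -/
theorem RowsWeaklyDecreasing.canHost_iff {b : ℕ → ℕ} {F : SetFilling}
    (h : RowsWeaklyDecreasing b F) {r c α : ℕ} :
    CanHost b F r c α ↔ anchor F r (c + 1) ≤ α ∧ α < anchor F r c := by
  constructor
  · rintro ⟨h1, -, h3⟩
    exact ⟨Finset.sup_le h3, h1⟩
  · rintro ⟨h1, h2⟩
    exact ⟨h2, fun x hx => h2.le.trans (h.anchorB_le hx), fun y hy => (le_anchor hy).trans h1⟩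

theorem ColumnsDistinct.eq {F : SetFilling} (h : ColumnsDistinct F) {c r r' x : ℕ}
    (hx : x ∈ F r c) (hx' : x ∈ F r' c) : r = r' := by
  by_contra hne
  exact Finset.disjoint_left.1 (h c r r' hne) hx hx'

/-! ### Triples and greedy columns -/

theorem HasSkylineShape.anchorB_succ_ne_zero_iff {b : ℕ → ℕ} {F : SetFilling} {γ : ℕ →₀ ℕ}
    (hF : HasSkylineShape F γ) (hpos : PosEntries F) {r k : ℕ} :
    anchorB b F r (k + 1) ≠ 0 ↔ k < γ r := by
  rw [anchorB_succ, anchor_ne_zero_iff hpos, hF]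

/-- In a type B triple, `b < c` rules out the first alternative and forces `a > b`. The basement
supplies `b < c` in column `0`, and the decrease of row `i` carries it to the next column. -/
theorem TriplesInversion.anchorB_lt_anchorB_succ {F : SetFilling} {γ : ℕ →₀ ℕ}
    (hF : HasSkylineShape F γ) (hrow : RowsWeaklyDecreasing stdBasement F)
    (htri : TriplesInversion stdBasement γ F) {i j : ℕ} (hij : i < j) (hγ : γ i < γ j) (k : ℕ)
    (hk : k ≤ γ i) :
    anchorB stdBasement F i k < anchorB stdBasement F j (k + 1) := by
  have key : anchorB stdBasement F i k < anchorB stdBasement F j k →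
      anchorB stdBasement F i k < anchorB stdBasement F j (k + 1) := by
    intro h
    rcases htri.2 i j k hij hγ hk with h' | h'
    · omega
    · exact h'.2
  induction k with
  | zero =>
    refine key ?_
    rw [anchorB_zero, anchorB_zero, stdBasement, stdBasement]
    omega
  | succ k ih =>
    refine key ((hrow.anchorB_succ_le hF i k).trans_lt (ih (by omega) ?_))
    intro h
    rcases htri.2 i j k hij hγ (by omega) with h' | h'
    · omega
    · exact h'.2

theorem TriplesInversion.isGreedy {F : SetFilling} {γ : ℕ →₀ ℕ}
    (hF : HasSkylineShape F γ) (hpos : PosEntries F) (hdist : ColumnsDistinct F)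
    (hrow : RowsWeaklyDecreasing stdBasement F)
    (htri : TriplesInversion stdBasement γ F) (k : ℕ) :
    IsGreedy (fun r => anchorB stdBasement F r k) (fun r => anchorB stdBasement F r (k + 1)) := by
  have hinj : ∀ i j, anchorB stdBasement F i (k + 1) ≠ 0 →
      anchorB stdBasement F i (k + 1) = anchorB stdBasement F j (k + 1) → i = j := by
    intro i j hi hij
    have hj := hij ▸ hi
    rw [anchorB_succ, anchor_ne_zero_iff hpos] at hi hj
    refine hdist.eq (anchor_mem hi) (c := k) ?_
    rw [anchorB_succ, anchorB_succ] at hij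
    rw [hij]
    exact anchor_mem hj
  refine ⟨fun r => hrow.anchorB_succ_le hF r k, hinj, ?_⟩
  intro i j hij hj hle
  have hj' := (hF.anchorB_succ_ne_zero_iff hpos).1 hj
  rcases lt_or_ge (γ i) (γ j) with hγ | hγ
  · have hk : k ≤ γ i := by
      cases k with
      | zero => omega
      | succ k =>
        have h1 : k < γ i := (hF.anchorB_succ_ne_zero_iff (b := stdBasement) hpos).1 (by omega)
        exact h1
    -- A shorter higher row never has room for the entry, so `hle` fails.
    have := htri.anchorB_lt_anchorB_succ hF hrow hij hγ k hk
    omega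
  · rcases htri.1 i j k hij hγ hj' with h' | h'
    · omega
    · exact h'.2

/-- Type A is a direct reading of greediness. If a type B triple failed, row `i` would dominate row
`j` from that column on, and so would have a box beyond its end. -/
theorem TriplesInversion.of_isGreedy {F : SetFilling} {γ : ℕ →₀ ℕ}
    (hF : HasSkylineShape F γ) (hpos : PosEntries F)
    (hg : ∀ k, IsGreedy (fun r => anchorB stdBasement F r k)
      (fun r => anchorB stdBasement F r (k + 1))) :
    TriplesInversion stdBasement γ F := by
  have hle : ∀ r k, anchorB stdBasement F r (k + 1) ≤ anchorB stdBasement F r k :=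
    fun r k => (hg k).le r
  have hlt : ∀ i j k, i < j → anchorB stdBasement F j (k + 1) ≠ 0 →
      anchorB stdBasement F j (k + 1) ≤ anchorB stdBasement F i k →
      anchorB stdBasement F j (k + 1) < anchorB stdBasement F i (k + 1) :=
    fun i j k => (hg k).lt i j
  refine ⟨fun i j k hij hγ hk => ?_, fun i j k hij hγ hk => ?_⟩
  · have hj := (hF.anchorB_succ_ne_zero_iff (b := stdBasement) hpos (r := j) (k := k)).2 hk
    have h1 := hle i k
    have h2 := hlt i j k hij hj
    unfold IsInversionTriple
    omega
  · have hnz : ∀ n, n < γ j → anchorB stdBasement F j (n + 1) ≠ 0 := fun n hn =>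
      (hF.anchorB_succ_ne_zero_iff hpos).2 hn
    have hstep : ∀ n, n ≤ γ i →
        anchorB stdBasement F i n < anchorB stdBasement F j (n + 1) := by
      intro n hn
      by_contra hcon
      have hpers : ∀ m, n ≤ m → m < γ j →
          anchorB stdBasement F j (m + 1) < anchorB stdBasement F i (m + 1) := by
        intro m hm
        induction m, hm using Nat.le_induction with
        | base => exact fun h => hlt i j n hij (hnz n h) (by omega)
        | succ m hm ih =>
          intro h
          have h1 := ih (by omega)
          have h2 := hle j (m + 1)
          exact hlt i j (m + 1) hij (hnz _ h) (by omega)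
      have h1 := hpers (γ i) hn hγ
      have h2 : γ i < γ i :=
        (hF.anchorB_succ_ne_zero_iff (b := stdBasement) hpos).1 (by omega)
      omega
    have h1 := hstep k hk
    have h2 := hle j k
    unfold IsInversionTriple
    omega

/-! ### Columns of a filling -/

/-- Every column has finitely many boxes. -/
def FiniteColumns (F : SetFilling) : Prop := ∀ c, {r | (F r c).Nonempty}.Finite

theorem nonempty_of_lt_anchor {F : SetFilling} {r c α : ℕ} (h : α < anchor F r c) :
    (F r c).Nonempty := by
  rw [Finset.nonempty_iff_ne_empty]
  intro h'
  rw [anchor, h'] at h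
  exact Nat.not_lt_zero _ h

theorem nonempty_of_mem_free {F : SetFilling} {r c α : ℕ} (h : α ∈ free F r c) :
    (F r c).Nonempty := ⟨α, (mem_free.1 h).1⟩

theorem mem_colRows {F : SetFilling} (hF : FiniteColumns F) {r c : ℕ} :
    r ∈ colRows F c ↔ (F r c).Nonempty := by
  rw [colRows, dif_pos (hF c)]
  simp

theorem mem_colFree {F : SetFilling} (hF : FiniteColumns F) {c α : ℕ} :
    α ∈ colFree F c ↔ ∃ r, α ∈ free F r c := by
  rw [colFree, Finset.mem_biUnion]
  exact exists_congr fun r =>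
    ⟨fun h => h.2, fun h => ⟨(mem_colRows hF).2 (nonempty_of_mem_free h), h⟩⟩

theorem mem_colAnchors {F : SetFilling} (hF : FiniteColumns F) {c a : ℕ} :
    a ∈ colAnchors F c ↔ ∃ r, (F r c).Nonempty ∧ anchor F r c = a := by
  simp [colAnchors, mem_colRows hF]

theorem mem_colAnchors_iff_anchor {F : SetFilling} (hF : FiniteColumns F) (hpos : PosEntries F)
    {c a : ℕ} : a ∈ colAnchors F c ↔ a ≠ 0 ∧ ∃ r, anchor F r c = a := by
  rw [mem_colAnchors hF]
  constructor
  · rintro ⟨r, h, rfl⟩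
    exact ⟨(anchor_ne_zero_iff hpos).2 h, r, rfl⟩
  · rintro ⟨h, r, rfl⟩
    exact ⟨r, (anchor_ne_zero_iff hpos).1 h, rfl⟩

theorem ColumnsDistinct.nodup_colAnchors {F : SetFilling} (h : ColumnsDistinct F)
    (hF : FiniteColumns F) (c : ℕ) : (colAnchors F c).Nodup := by
  rw [colAnchors]
  refine List.Nodup.map_on ?_ (Finset.sort_nodup _ _)
  intro r hr r' hr' hrr'
  rw [Finset.mem_sort, mem_colRows hF] at hr hr'
  refine h.eq (anchor_mem hr) (c := c) ?_
  rw [hrr']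
  exact anchor_mem hr'

theorem ColumnsDistinct.notMem_colAnchors {F : SetFilling} (h : ColumnsDistinct F)
    (hF : FiniteColumns F) {c α : ℕ} (hα : α ∈ colFree F c) : α ∉ colAnchors F c := by
  rw [mem_colAnchors hF]
  rintro ⟨r, hr, rfl⟩
  obtain ⟨r', hr'⟩ := (mem_colFree hF).1 hα
  rw [mem_free] at hr'
  have := h.eq (anchor_mem hr) hr'.1
  subst this
  exact lt_irrefl _ hr'.2

/-- The number of anchor entries of column `c` that are larger than `α`. -/
noncomputable def anchorCount (F : SetFilling) (c α : ℕ) : ℕ :=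
  (colAnchors F c).countP (α < ·)

/-- The rows whose anchor in column `c` is larger than `α`. -/
noncomputable def rowsAbove (F : SetFilling) (c α : ℕ) : Finset ℕ :=
  (colRows F c).filter fun r => α < anchor F r c

theorem mem_rowsAbove {F : SetFilling} (hF : FiniteColumns F) {r c α : ℕ} :
    r ∈ rowsAbove F c α ↔ α < anchor F r c := by
  rw [rowsAbove, Finset.mem_filter, mem_colRows hF]
  exact ⟨fun h => h.2, fun h => ⟨nonempty_of_lt_anchor h, h⟩⟩

/-- The set of rows compares neighbouring columns by inclusion; the list count is invariant under
permutation. The proofs switch between the two. -/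
theorem card_rowsAbove (F : SetFilling) (c α : ℕ) :
    (rowsAbove F c α).card = anchorCount F c α := by
  rw [anchorCount, colAnchors, List.countP_map, rowsAbove, Finset.card_def, Finset.filter_val,
    ← Multiset.countP_eq_card_filter]
  conv_lhs => rw [← Finset.sort_eq (colRows F c) (· ≤ ·)]
  rw [Multiset.coe_countP]
  rfl

theorem anchorCount_eq_of_perm {F G : SetFilling} {c : ℕ}
    (h : (colAnchors F c).Perm (colAnchors G c)) (α : ℕ) :
    anchorCount F c α = anchorCount G c α := h.countP_eq _

theorem sortedAnchors_perm (F : SetFilling) (c : ℕ) :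
    (sortedAnchors F c).Perm (colAnchors F c) := List.perm_insertionSort _ _

theorem pairwise_ge_sortedAnchors (F : SetFilling) (c : ℕ) :
    (sortedAnchors F c).Pairwise (· ≥ ·) := List.pairwise_insertionSort _ _

theorem lt_sortedAnchors_getD_iff {F : SetFilling} {c α r : ℕ} :
    α < (sortedAnchors F c).getD r 0 ↔ r < anchorCount F c α := by
  rw [lt_getD_iff_lt_countP (pairwise_ge_sortedAnchors F c), anchorCount,
    (sortedAnchors_perm F c).countP_eq]

theorem ColumnsDistinct.pairwise_gt_sortedAnchors {F : SetFilling} (h : ColumnsDistinct F)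
    (hF : FiniteColumns F) (c : ℕ) : (sortedAnchors F c).Pairwise (· > ·) := by
  have h1 : (sortedAnchors F c).Nodup :=
    (sortedAnchors_perm F c).nodup_iff.2 (h.nodup_colAnchors hF c)
  refine ((pairwise_ge_sortedAnchors F c).and h1).imp ?_
  rintro a b ⟨h1, h2⟩
  exact lt_of_le_of_ne h1 (Ne.symm h2)

theorem getD_mem_of_lt_length {l : List ℕ} {r : ℕ} (h : r < l.length) : l.getD r 0 ∈ l := by
  rw [List.getD_eq_getElem _ _ h]
  exact List.getElem_mem h

theorem getD_zero_eq_zero_or_mem (l : List ℕ) (r : ℕ) : l.getD r 0 = 0 ∨ l.getD r 0 ∈ l := by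
  rcases lt_or_ge r l.length with h | h
  · exact Or.inr (getD_mem_of_lt_length h)
  · exact Or.inl (List.getD_eq_default _ _ h)

theorem colAnchors_eq_of_forall_nonempty_iff {F : SetFilling} {c n : ℕ}
    (h : ∀ r, (F r c).Nonempty ↔ r < n) :
    colAnchors F c = (List.range n).map fun r => anchor F r c := by
  have h1 : colRows F c = Finset.range n := by
    have h2 : {r | (F r c).Nonempty} = ↑(Finset.range n) := by
      ext r
      simp [h]
    have hfin : {r | (F r c).Nonempty}.Finite := h2 ▸ Finset.finite_toSet _
    rw [colRows, dif_pos hfin]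
    ext r
    simp [h]
  rw [colAnchors, h1]
  congr 1
  refine List.Perm.eq_of_pairwise' (r := (· ≤ ·)) (Finset.pairwise_sort _ _)
    List.pairwise_le_range ?_
  rw [← Multiset.coe_eq_coe, Finset.sort_eq]
  rfl

/-! ### The map `rhoHat` -/

section RhoHat

variable {F : SetFilling}

theorem sortedAnchors_getD_pos (hF : FiniteColumns F) (hpos : PosEntries F) {r c : ℕ}
    (hr : r < (sortedAnchors F c).length) : 0 < (sortedAnchors F c).getD r 0 := by
  have h := getD_mem_of_lt_length hr
  rw [(sortedAnchors_perm F c).mem_iff, mem_colAnchors_iff_anchor hF hpos] at h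
  exact Nat.pos_of_ne_zero h.1

theorem mem_rhoHat {r c x : ℕ} :
    x ∈ rhoHat F r c ↔ r < (sortedAnchors F c).length ∧
      (x = (sortedAnchors F c).getD r 0 ∨
        x ∈ colFree F c ∧ (sortedAnchors F c).getD (r + 1) 0 < x ∧
          x < (sortedAnchors F c).getD r 0) := by
  unfold rhoHat
  split_ifs with h
  · rw [Finset.mem_insert, Finset.mem_filter]
    tauto
  · simp [h]

theorem rhoHat_nonempty_iff {r c : ℕ} :
    (rhoHat F r c).Nonempty ↔ r < (sortedAnchors F c).length :=
  ⟨fun ⟨_, hx⟩ => (mem_rhoHat.1 hx).1, fun h => ⟨_, mem_rhoHat.2 ⟨h, Or.inl rfl⟩⟩⟩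

theorem anchor_rhoHat (r c : ℕ) : anchor (rhoHat F) r c = (sortedAnchors F c).getD r 0 := by
  by_cases h : r < (sortedAnchors F c).length
  · refine le_antisymm (Finset.sup_le fun x hx => ?_) (le_anchor (mem_rhoHat.2 ⟨h, Or.inl rfl⟩))
    rcases (mem_rhoHat.1 hx).2 with h | h
    · exact h.le
    · exact h.2.2.le
  · rw [List.getD_eq_default _ _ (not_lt.1 h), anchor]
    have h1 : rhoHat F r c = ∅ := by
      rw [← Finset.not_nonempty_iff_eq_empty, rhoHat_nonempty_iff]
      exact h
    rw [h1]
    rfl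

theorem mem_free_rhoHat {r c α : ℕ} :
    α ∈ free (rhoHat F) r c ↔ α ∈ colFree F c ∧ (sortedAnchors F c).getD (r + 1) 0 < α ∧
      α < (sortedAnchors F c).getD r 0 := by
  rw [mem_free, anchor_rhoHat, mem_rhoHat]
  constructor
  · rintro ⟨⟨h, h1 | h1⟩, h2⟩
    · omega
    · exact h1
  · intro h
    refine ⟨⟨?_, Or.inr h⟩, h.2.2⟩
    by_contra hr
    rw [List.getD_eq_default _ _ (not_lt.1 hr)] at h
    omega

theorem finiteColumns_rhoHat (F : SetFilling) : FiniteColumns (rhoHat F) := by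
  intro c
  simp_rw [rhoHat_nonempty_iff]
  exact Set.finite_lt_nat _

theorem colAnchors_rhoHat (F : SetFilling) (c : ℕ) :
    colAnchors (rhoHat F) c = sortedAnchors F c := by
  rw [colAnchors_eq_of_forall_nonempty_iff (fun r => rhoHat_nonempty_iff)]
  refine List.ext_getElem (by simp) ?_
  intro n h1 h2
  simp [anchor_rhoHat, h2]

theorem colFree_rhoHat (hF : FiniteColumns F) (hpos : PosEntries F) (hdist : ColumnsDistinct F)
    (c : ℕ) : colFree (rhoHat F) c = colFree F c := by
  ext α
  rw [mem_colFree (finiteColumns_rhoHat F)]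
  simp_rw [mem_free_rhoHat]
  constructor
  · rintro ⟨r, h⟩
    exact h.1
  · intro h
    obtain ⟨r, hr⟩ := (mem_colFree hF).1 h
    rw [mem_free] at hr
    have h1 : 0 < anchorCount F c α := by
      rw [← card_rowsAbove, Finset.card_pos]
      exact ⟨r, (mem_rowsAbove hF).2 hr.2⟩
    -- The row of the last sorted anchor exceeding `α`; the count is positive because of the box
    -- containing `α` in `F`.
    refine ⟨anchorCount F c α - 1, h, ?_, ?_⟩
    · have h2 : ¬ α < (sortedAnchors F c).getD (anchorCount F c α - 1 + 1) 0 := by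
        rw [lt_sortedAnchors_getD_iff]
        omega
      refine lt_of_le_of_ne (not_lt.1 h2) ?_
      intro heq
      -- Equality with the next anchor is excluded: the default `0` by positivity, a genuine anchor
      -- by distinctness in the column.
      rcases getD_zero_eq_zero_or_mem (sortedAnchors F c) (anchorCount F c α - 1 + 1) with h3 | h3
      · have := hpos r c α hr.1
        omega
      · rw [heq, (sortedAnchors_perm F c).mem_iff] at h3
        exact hdist.notMem_colAnchors hF h h3
    · rw [lt_sortedAnchors_getD_iff]
      omega

end RhoHat

/-! ### Partitions and compositions -/

theorem mem_partitionOf {γ : ℕ →₀ ℕ} {i j : ℕ} :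
    (i, j) ∈ partitionOf γ ↔ i < (γ.support.filter fun r => j < γ r).card := by
  set w := (γ.support.val.map γ).sort (· ≥ ·) with hw
  have hsort : w.Pairwise (· ≥ ·) := Multiset.pairwise_sort _ _
  have h1 : (i, j) ∈ partitionOf γ ↔ j < w.getD i 0 := by
    rw [partitionOf, YoungDiagram.mem_ofRowLens]
    constructor
    · rintro ⟨h, h'⟩
      rw [List.getD_eq_getElem _ _ h]
      exact h'
    · intro h
      have hi : i < w.length := by
        by_contra hi
        rw [List.getD_eq_default _ _ (not_lt.1 hi)] at h
        omega
      rw [List.getD_eq_getElem _ _ hi] at h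
      exact ⟨hi, h⟩
  rw [h1, lt_getD_iff_lt_countP hsort, ← Multiset.coe_countP, hw, Multiset.sort_eq,
    Multiset.countP_map, Finset.card_def, Finset.filter_val]

/-- A diagram is determined by its column lengths, and these count parts without regard to their
order. -/
theorem partitionOf_eq_iff {γ : ℕ →₀ ℕ} {μ : YoungDiagram} :
    partitionOf γ = μ ↔ ∀ c, (γ.support.filter fun r => c < γ r).card = μ.colLen c := by
  constructor
  · rintro rfl c
    refine Nat.le_antisymm (Nat.le_of_not_lt fun h => ?_) (Nat.le_of_not_lt fun h => ?_)
    · rw [← mem_partitionOf, YoungDiagram.mem_iff_lt_colLen] at h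
      exact lt_irrefl _ h
    · rw [← YoungDiagram.mem_iff_lt_colLen, mem_partitionOf] at h
      exact lt_irrefl _ h
  · intro h
    ext ⟨i, j⟩
    rw [YoungDiagram.mem_cells, YoungDiagram.mem_cells, mem_partitionOf, h,
      YoungDiagram.mem_iff_lt_colLen]

theorem HasSkylineShape.finiteColumns {F : SetFilling} {γ : ℕ →₀ ℕ} (h : HasSkylineShape F γ) :
    FiniteColumns F := by
  intro c
  refine γ.support.finite_toSet.subset ?_
  intro r hr
  have hr' : c < γ r := (h r c).1 hr
  simp only [Finset.mem_coe, Finsupp.mem_support_iff]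
  omega

theorem HasSkylineShape.length_colAnchors {F : SetFilling} {γ : ℕ →₀ ℕ}
    (h : HasSkylineShape F γ) (c : ℕ) :
    (colAnchors F c).length = (γ.support.filter fun r => c < γ r).card := by
  rw [colAnchors, List.length_map, Finset.length_sort]
  congr 1
  ext r
  rw [mem_colRows h.finiteColumns, h, Finset.mem_filter, Finsupp.mem_support_iff]
  omega

theorem anchorCount_succ_le {F : SetFilling} (hF : FiniteColumns F) {c : ℕ}
    (hrow : ∀ r, anchor F r (c + 1) ≤ anchor F r c) (α : ℕ) :
    anchorCount F (c + 1) α ≤ anchorCount F c α := by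
  rw [← card_rowsAbove, ← card_rowsAbove]
  refine Finset.card_le_card fun r hr => ?_
  rw [mem_rowsAbove hF] at hr ⊢
  exact hr.trans_le (hrow r)

/-- Row `r` is counted in column `c` but not in column `c + 1`, while every row counted in the
latter is counted in the former. -/
theorem anchorCount_succ_lt {F : SetFilling} (hF : FiniteColumns F) {c r α : ℕ}
    (hrow : ∀ r, anchor F r (c + 1) ≤ anchor F r c) (h1 : anchor F r (c + 1) ≤ α)
    (h2 : α < anchor F r c) : anchorCount F (c + 1) α < anchorCount F c α := by
  rw [← card_rowsAbove, ← card_rowsAbove]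
  refine Finset.card_lt_card (Finset.ssubset_iff_of_subset (fun r hr => ?_) |>.2 ⟨r, ?_, ?_⟩)
  · rw [mem_rowsAbove hF] at hr ⊢
    exact hr.trans_le (hrow r)
  · rwa [mem_rowsAbove hF]
  · rw [mem_rowsAbove hF]
    omega

theorem rhoHat_mem_setRT {F : SetFilling} {γ : ℕ →₀ ℕ} (h : F ∈ SetSkyFill γ) :
    rhoHat F ∈ SetRT (partitionOf γ) := by
  obtain ⟨hsh, hpos, hdist, hrow, -, -⟩ := h
  have hfin := hsh.finiteColumns
  have hanch : ∀ c r, anchor F r (c + 1) ≤ anchor F r c := fun c r =>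
    hrow.anchorB_succ_le hsh r (c + 1)
  have hanti : ∀ r c, (sortedAnchors F c).getD (r + 1) 0 ≤ (sortedAnchors F c).getD r 0 := by
    intro r c
    by_contra hcon
    rw [not_le, lt_sortedAnchors_getD_iff] at hcon
    have : r < anchorCount F c ((sortedAnchors F c).getD r 0) := by omega
    rw [← lt_sortedAnchors_getD_iff] at this
    omega
  refine ⟨fun r c => ?_, fun r c x hx => ?_, fun r c x hx y hy => ?_, fun r c x hx y hy => ?_⟩
  · rw [rhoHat_nonempty_iff, (sortedAnchors_perm F c).length_eq, hsh.length_colAnchors,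
      mem_partitionOf]
  · rcases (mem_rhoHat.1 hx).2 with rfl | h
    · exact sortedAnchors_getD_pos hfin hpos (mem_rhoHat.1 hx).1
    · omega
  · refine (le_anchor hy).trans ?_
    rw [anchor_rhoHat]
    by_contra hcon
    rw [not_le, lt_sortedAnchors_getD_iff] at hcon
    rcases (mem_rhoHat.1 hx).2 with rfl | ⟨h1, h2, -⟩
    · have := hcon.trans_le (anchorCount_succ_le hfin (hanch c) _)
      rw [← lt_sortedAnchors_getD_iff] at this
      exact lt_irrefl _ this
    · obtain ⟨i, hi⟩ := (mem_colFree hfin).1 h1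
      rw [mem_free] at hi
      -- The strict drop in the count contradicts `h2`: with more than `r` anchors above `x` in
      -- column `c + 1`, column `c` has more than `r + 1`, so its sorted anchor `r + 1` exceeds `x`.
      have h3 := anchorCount_succ_lt hfin (hanch c)
        (hrow.anchorB_le (k := c + 1) (b := stdBasement) hi.1) hi.2
      have h4 : r + 1 < anchorCount F c x := by omega
      rw [← lt_sortedAnchors_getD_iff] at h4
      omega
  · have hy' := le_anchor hy
    have hylen := (mem_rhoHat.1 hy).1
    rw [anchor_rhoHat] at hy'
    refine hy'.trans_lt ?_
    rcases (mem_rhoHat.1 hx).2 with rfl | h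
    · have hs := hdist.pairwise_gt_sortedAnchors hfin c
      rw [List.getD_eq_getElem _ _ hylen, List.getD_eq_getElem _ _ (by omega)]
      exact List.pairwise_iff_getElem.1 hs r (r + 1) (by omega) hylen (by omega)
    · exact h.2.1

/-! ### The insertion of anchors -/

theorem mem_insertAnchors {T : SetFilling} {r c x : ℕ} :
    x ∈ insertAnchors T r c ↔ insertColumn T (c + 1) r ≠ 0 ∧ x = insertColumn T (c + 1) r := by
  unfold insertAnchors
  split_ifs with h
  · simp [h]
  · simp [h]

theorem anchor_insertAnchors (T : SetFilling) (r c : ℕ) :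
    anchor (insertAnchors T) r c = insertColumn T (c + 1) r := by
  unfold anchor insertAnchors
  split_ifs with h
  · simp [h]
  · simp

theorem rowsWeaklyDecreasing_insertAnchors {T : SetFilling}
    (hle : ∀ k r, insertColumn T (k + 1) r ≤ insertColumn T k r) :
    RowsWeaklyDecreasing stdBasement (insertAnchors T) := by
  intro r k x hx y hy
  have hy' := (mem_insertAnchors.1 hy).2
  have hx' : x = insertColumn T k r := by
    cases k with
    | zero => exact Finset.mem_singleton.1 hx
    | succ k => exact (mem_insertAnchors.1 hx).2
  rw [hx', hy']
  exact hle k r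

theorem canHost_insertAnchors_iff {T : SetFilling}
    (hle : ∀ k r, insertColumn T (k + 1) r ≤ insertColumn T k r) {r c α : ℕ} :
    CanHost stdBasement (insertAnchors T) r c α ↔
      insertColumn T (c + 1 + 1) r ≤ α ∧ α < insertColumn T (c + 1) r := by
  rw [(rowsWeaklyDecreasing_insertAnchors hle).canHost_iff, anchor_insertAnchors,
    anchor_insertAnchors]

open Classical in
theorem mem_rhoHatInv {T : SetFilling} {r c x : ℕ} :
    x ∈ rhoHatInv T r c ↔ x ∈ insertAnchors T r c ∨ (x ∈ colFree T c ∧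
      CanHost stdBasement (insertAnchors T) r c x ∧
        ∀ r' < r, ¬ CanHost stdBasement (insertAnchors T) r' c x) := by
  rw [rhoHatInv, Finset.mem_union, Finset.mem_filter]

theorem anchor_rhoHatInv (T : SetFilling) (r c : ℕ) :
    anchor (rhoHatInv T) r c = insertColumn T (c + 1) r := by
  refine le_antisymm (Finset.sup_le fun x hx => ?_) ?_
  · rcases mem_rhoHatInv.1 hx with h | h
    · exact (mem_insertAnchors.1 h).2.le
    · have := h.2.1.1
      rw [anchor_insertAnchors] at this
      exact this.le
  · by_cases h : insertColumn T (c + 1) r = 0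
    · rw [h]; exact Nat.zero_le _
    · exact le_anchor (mem_rhoHatInv.2 (Or.inl (mem_insertAnchors.2 ⟨h, rfl⟩)))

theorem mem_free_rhoHatInv {T : SetFilling} {r c x : ℕ} :
    x ∈ free (rhoHatInv T) r c ↔ x ∈ colFree T c ∧
      CanHost stdBasement (insertAnchors T) r c x ∧
        ∀ r' < r, ¬ CanHost stdBasement (insertAnchors T) r' c x := by
  rw [mem_free, anchor_rhoHatInv, mem_rhoHatInv, mem_insertAnchors]
  constructor
  · rintro ⟨h | h, h'⟩
    · omega
    · exact h
  · intro h
    have := h.2.1.1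
    rw [anchor_insertAnchors] at this
    exact ⟨Or.inr h, this⟩

theorem nonempty_rhoHatInv_iff {T : SetFilling} {r c : ℕ} :
    (rhoHatInv T r c).Nonempty ↔ insertColumn T (c + 1) r ≠ 0 := by
  constructor
  · rintro ⟨x, hx⟩
    rcases mem_rhoHatInv.1 hx with h | h
    · exact (mem_insertAnchors.1 h).1
    · have := h.2.1.1
      rw [anchor_insertAnchors] at this
      omega
  · exact fun h => ⟨_, mem_rhoHatInv.2 (Or.inl (mem_insertAnchors.2 ⟨h, rfl⟩))⟩

/-- The anchor columns of `F` are greedy, so inserting the same entries rebuilds them, and hosting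
is then the same in both fillings. -/
theorem rhoHatInv_rhoHat {F : SetFilling} {γ : ℕ →₀ ℕ} (h : F ∈ SetSkyFill γ) :
    rhoHatInv (rhoHat F) = F := by
  obtain ⟨hsh, hpos, hdist, hrow, htri, hhigh⟩ := h
  have hfin := hsh.finiteColumns
  have hins : ∀ k, insertColumn (rhoHat F) k = fun r => anchorB stdBasement F r k := by
    intro k
    induction k with
    | zero =>
      funext r
      rw [anchorB_zero, insertColumn]
    | succ k ih =>
      rw [insertColumn, ih, colAnchors_rhoHat]
      refine (htri.isGreedy hsh hpos hdist hrow k).foldl_placeAnchor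
        (hdist.pairwise_gt_sortedAnchors hfin k) fun a => ?_
      rw [(sortedAnchors_perm F k).mem_iff, mem_colAnchors_iff_anchor hfin hpos]
      rfl
  have hhost : ∀ r c α, CanHost stdBasement (insertAnchors (rhoHat F)) r c α ↔
      CanHost stdBasement F r c α := by
    intro r c α
    rw [canHost_insertAnchors_iff, hrow.canHost_iff, hins, hins]
    · rfl
    intro k r
    rw [hins, hins]
    exact hrow.anchorB_succ_le hsh r k
  have hcan : ∀ r c α, α ∈ free F r c → CanHost stdBasement F r c α := by
    intro r c α hα
    rw [mem_free] at hα
    exact hrow.canHost_iff.2 ⟨hrow.anchorB_le (k := c + 1) (b := stdBasement) hα.1, hα.2⟩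
  funext r c
  ext x
  rw [mem_rhoHatInv, mem_insertAnchors, hins, colFree_rhoHat hfin hpos hdist,
    mem_iff_eq_anchor_or_mem_free, ← anchor_ne_zero_iff hpos]
  simp_rw [hhost]
  refine or_congr Iff.rfl ⟨?_, fun hx => ⟨(mem_colFree hfin).2 ⟨r, hx⟩, hcan r c x hx,
    fun r' hr' => hhigh r c x hx r' hr'⟩⟩
  rintro ⟨hx, h1, h2⟩
  obtain ⟨i, hi⟩ := (mem_colFree hfin).1 hx
  -- Both `i` and `r` are the highest row that can host `x`.
  rcases lt_trichotomy i r with hir | rfl | hir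
  · exact absurd (hcan i c x hi) (h2 i hir)
  · exact hi
  · exact absurd h1 (hhigh i c x hi r hir)

/-! ### Set-valued reverse tableaux -/

section SetRT

variable {μ : YoungDiagram} {T : SetFilling}

theorem nonempty_iff_of_mem_setRT (hT : T ∈ SetRT μ) {r c : ℕ} :
    (T r c).Nonempty ↔ r < μ.colLen c := by
  rw [hT.1, YoungDiagram.mem_iff_lt_colLen]

theorem finiteColumns_of_mem_setRT (hT : T ∈ SetRT μ) : FiniteColumns T := by
  intro c
  simp_rw [nonempty_iff_of_mem_setRT hT]
  exact Set.finite_lt_nat _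

theorem lt_of_mem_setRT (hT : T ∈ SetRT μ) {i j c x y : ℕ} (hij : i < j) (hx : x ∈ T i c)
    (hy : y ∈ T j c) : y < x := by
  induction j, hij using Nat.le_induction generalizing y with
  | base => exact hT.2.2.2 i c x hx y hy
  | succ j hj ih =>
    have h1 : (T j c).Nonempty := by
      have := (nonempty_iff_of_mem_setRT hT).1 ⟨y, hy⟩
      rw [nonempty_iff_of_mem_setRT hT]
      omega
    obtain ⟨z, hz⟩ := h1
    exact (hT.2.2.2 j c z hz y hy).trans (ih hz)

theorem columnsDistinct_of_mem_setRT (hT : T ∈ SetRT μ) : ColumnsDistinct T := by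
  intro c r r' hne
  rw [Finset.disjoint_left]
  intro x hx hx'
  rcases hne.lt_or_gt with h | h
  · exact lt_irrefl _ (lt_of_mem_setRT hT h hx hx')
  · exact lt_irrefl _ (lt_of_mem_setRT hT h hx' hx)

theorem anchor_lt_of_mem_setRT (hT : T ∈ SetRT μ) {i j c : ℕ} (hij : i < j)
    (hj : j < μ.colLen c) : anchor T j c < anchor T i c :=
  lt_of_mem_setRT hT hij (anchor_mem ((nonempty_iff_of_mem_setRT hT).2 (hij.trans hj)))
    (anchor_mem ((nonempty_iff_of_mem_setRT hT).2 hj))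

theorem anchor_succ_le_of_mem_setRT (hT : T ∈ SetRT μ) {r c x : ℕ} (hx : x ∈ T r c) :
    anchor T r (c + 1) ≤ x := Finset.sup_le fun y hy => hT.2.2.1 r c x hx y hy

theorem anchor_succ_le_anchor_of_mem_setRT (hT : T ∈ SetRT μ) (r c : ℕ) :
    anchor T r (c + 1) ≤ anchor T r c := by
  by_cases h : (T r (c + 1)).Nonempty
  · refine anchor_succ_le_of_mem_setRT hT (anchor_mem ?_)
    rw [hT.1] at h ⊢
    exact μ.up_left_mem le_rfl (Nat.le_succ c) h
  · rw [Finset.not_nonempty_iff_eq_empty] at h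
    rw [anchor, h]
    exact Nat.zero_le _

theorem colAnchors_of_mem_setRT (hT : T ∈ SetRT μ) (c : ℕ) :
    colAnchors T c = (List.range (μ.colLen c)).map fun r => anchor T r c :=
  colAnchors_eq_of_forall_nonempty_iff fun _ => nonempty_iff_of_mem_setRT hT

theorem length_colAnchors_of_mem_setRT (hT : T ∈ SetRT μ) (c : ℕ) :
    (colAnchors T c).length = μ.colLen c := by
  rw [colAnchors_of_mem_setRT hT, List.length_map, List.length_range]

theorem pairwise_gt_colAnchors_of_mem_setRT (hT : T ∈ SetRT μ) (c : ℕ) :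
    (colAnchors T c).Pairwise (· > ·) := by
  rw [colAnchors_of_mem_setRT hT, List.pairwise_map]
  refine List.pairwise_lt_range.imp_of_mem fun _ hb hab => ?_
  exact anchor_lt_of_mem_setRT hT hab (List.mem_range.1 hb)

theorem colAnchors_getD_of_mem_setRT (hT : T ∈ SetRT μ) (r c : ℕ) :
    (colAnchors T c).getD r 0 = anchor T r c := by
  by_cases h : r < μ.colLen c
  · simp [colAnchors_of_mem_setRT hT, h]
  · rw [List.getD_eq_default _ _ (by rw [length_colAnchors_of_mem_setRT hT]; omega)]
    by_contra hne
    exact h ((nonempty_iff_of_mem_setRT hT).1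
      ((anchor_ne_zero_iff hT.2.1).1 (Ne.symm hne)))

/-- Successive anchors of a column bound disjoint intervals, so the column data alone locate each
free entry. This is the rule defining `rhoHat`. -/
theorem mem_free_iff_of_mem_setRT (hT : T ∈ SetRT μ) {r c x : ℕ} :
    x ∈ free T r c ↔ x ∈ colFree T c ∧ anchor T (r + 1) c < x ∧ x < anchor T r c := by
  have hfin := finiteColumns_of_mem_setRT hT
  constructor
  · intro h
    refine ⟨(mem_colFree hfin).2 ⟨r, h⟩, ?_, (mem_free.1 h).2⟩
    by_cases h1 : anchor T (r + 1) c = 0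
    · rw [h1]
      exact hT.2.1 r c x (mem_free.1 h).1
    · exact lt_of_mem_setRT hT (Nat.lt_succ_self r) (mem_free.1 h).1
        (anchor_mem ((anchor_ne_zero_iff hT.2.1).1 h1))
  · rintro ⟨h, h1, h2⟩
    obtain ⟨i, hi⟩ := (mem_colFree hfin).1 h
    have hix := (mem_free.1 hi).1
    rcases lt_trichotomy i r with hir | rfl | hir
    · have := lt_of_mem_setRT hT hir hix (anchor_mem (nonempty_of_lt_anchor h2))
      omega
    · exact hi
    · rcases Nat.eq_or_lt_of_le (Nat.succ_le_of_lt hir) with heq | hlt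
      · rw [Nat.succ_eq_add_one] at heq
        rw [heq] at h1
        exact absurd (le_anchor hix) (by omega)
      · rw [Nat.succ_eq_add_one] at hlt
        have hne : (T (r + 1) c).Nonempty := by
          have := (nonempty_iff_of_mem_setRT hT).1 ⟨x, hix⟩
          rw [nonempty_iff_of_mem_setRT hT]
          omega
        have := lt_of_mem_setRT hT hlt (anchor_mem hne) hix
        omega

/-! ### The map `rhoHatInv` -/

/-- The room needed for anchor `n` of column `k + 1` of `T` comes from anchors `0, …, n` of column
`k`: all are at least as large, and insertion has put them in `n + 1` different rows. -/
theorem insertColumn_spec (hT : T ∈ SetRT μ) (k : ℕ) :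
    IsGreedy (insertColumn T k) (insertColumn T (k + 1)) ∧
      (∀ a, a ∈ colAnchors T k ↔ a ≠ 0 ∧ ∃ r, insertColumn T (k + 1) r = a) ∧
      ∃ s : Finset ℕ, s.card = (colAnchors T k).length ∧
        ∀ r, r ∈ s ↔ insertColumn T (k + 1) r ≠ 0 := by
  have hfin := finiteColumns_of_mem_setRT hT
  have hpos : ∀ k, ∀ a ∈ colAnchors T k, a ≠ 0 := fun k a ha =>
    ((mem_colAnchors_iff_anchor hfin hT.2.1).1 ha).1
  induction k with
  | zero =>
    refine isGreedy_foldl_placeAnchor _ _ (pairwise_gt_colAnchors_of_mem_setRT hT 0) (hpos 0) ?_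
    intro n _
    -- The basement of row `r` is `r + 1`, so every row from the value of the entry onwards admits
    -- it; `n + 1` of them are taken.
    refine ⟨Finset.Ico ((colAnchors T 0).getD n 0) ((colAnchors T 0).getD n 0 + n + 1),
      ?_, fun r hr => ?_⟩
    · rw [Nat.card_Ico]
      omega
    · rw [Finset.mem_Ico] at hr
      simp only [insertColumn, stdBasement]
      omega
  | succ k ih =>
    refine isGreedy_foldl_placeAnchor _ _ (pairwise_gt_colAnchors_of_mem_setRT hT (k + 1))
      (hpos (k + 1)) ?_
    intro n hn
    rw [length_colAnchors_of_mem_setRT hT, ← nonempty_iff_of_mem_setRT hT] at hn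
    have hn' : n < μ.colLen k := by
      rw [← YoungDiagram.mem_iff_lt_colLen]
      exact μ.up_left_mem le_rfl (Nat.le_succ k) ((hT.1 _ _).1 hn)
    -- `f i` will be the row into which anchor `i` was inserted, with a dummy value beyond the
    -- column.
    have hex : ∀ i, ∃ r, i < μ.colLen k → insertColumn T (k + 1) r = anchor T i k := by
      intro i
      by_cases hi : i < μ.colLen k
      · obtain ⟨r, hr⟩ := ((ih.2.1 (anchor T i k)).1
          ((mem_colAnchors hfin).2 ⟨i, (nonempty_iff_of_mem_setRT hT).2 hi, rfl⟩)).2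
        exact ⟨r, fun _ => hr⟩
      · exact ⟨0, fun h => absurd h hi⟩
    choose f hf using hex
    refine ⟨(Finset.range (n + 1)).image f, ?_, ?_⟩
    · rw [Finset.card_image_of_injOn, Finset.card_range]
      · omega
      · intro i hi j hj hij
        simp only [Finset.coe_range, Set.mem_Iio] at hi hj
        have h1 := hf i (by omega)
        have h2 := hf j (by omega)
        rw [hij, h2] at h1
        rcases lt_trichotomy i j with h | h | h
        · have := anchor_lt_of_mem_setRT hT h (c := k) (by omega)
          omega
        · exact h
        · have := anchor_lt_of_mem_setRT hT h (c := k) (by omega)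
          omega
    · intro r hr
      rw [Finset.mem_image] at hr
      obtain ⟨i, hi, rfl⟩ := hr
      rw [Finset.mem_range] at hi
      rw [hf i (by omega), colAnchors_getD_of_mem_setRT hT]
      refine (anchor_succ_le_anchor_of_mem_setRT hT n k).trans ?_
      rcases Nat.eq_or_lt_of_le (Nat.le_of_lt_succ hi) with h | h
      · rw [h]
      · exact (anchor_lt_of_mem_setRT hT h hn').le

theorem insertColumn_succ_le (hT : T ∈ SetRT μ) (k r : ℕ) :
    insertColumn T (k + 1) r ≤ insertColumn T k r := (insertColumn_spec hT k).1.le r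

theorem posEntries_rhoHatInv (hT : T ∈ SetRT μ) : PosEntries (rhoHatInv T) := by
  intro r c x hx
  rcases mem_rhoHatInv.1 hx with h | h
  · have := mem_insertAnchors.1 h
    omega
  · obtain ⟨i, hi⟩ := (mem_colFree (finiteColumns_of_mem_setRT hT)).1 h.1
    exact hT.2.1 i c x (mem_free.1 hi).1

theorem columnsDistinct_rhoHatInv (hT : T ∈ SetRT μ) : ColumnsDistinct (rhoHatInv T) := by
  have hfin := finiteColumns_of_mem_setRT hT
  have key : ∀ c x, x ∈ colFree T c → ∀ r, x ∉ insertAnchors T r c := by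
    intro c x hx r hr
    refine (columnsDistinct_of_mem_setRT hT).notMem_colAnchors hfin hx ?_
    rw [(insertColumn_spec hT c).2.1]
    have := mem_insertAnchors.1 hr
    exact ⟨by omega, r, this.2.symm⟩
  intro c r r' hne
  rw [Finset.disjoint_left]
  intro x hx hx'
  rcases mem_rhoHatInv.1 hx with h | h <;> rcases mem_rhoHatInv.1 hx' with h' | h'
  · rw [mem_insertAnchors] at h h'
    exact hne ((insertColumn_spec hT c).1.inj r r' h.1 (h.2.symm.trans h'.2))
  · exact key c x h'.1 r h
  · exact key c x h.1 r' h'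
  · rcases hne.lt_or_gt with hlt | hlt
    · exact h'.2.2 r hlt h.2.1
    · exact h.2.2 r' hlt h'.2.1

theorem finiteColumns_rhoHatInv (hT : T ∈ SetRT μ) : FiniteColumns (rhoHatInv T) := by
  intro c
  obtain ⟨s, -, hs⟩ := (insertColumn_spec hT c).2.2
  simp_rw [nonempty_rhoHatInv_iff, ← hs]
  exact s.finite_toSet

theorem colAnchors_rhoHatInv_perm (hT : T ∈ SetRT μ) (c : ℕ) :
    (colAnchors (rhoHatInv T) c).Perm (colAnchors T c) := by
  refine (List.perm_ext_iff_of_nodup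
    ((columnsDistinct_rhoHatInv hT).nodup_colAnchors (finiteColumns_rhoHatInv hT) c)
    ((columnsDistinct_of_mem_setRT hT).nodup_colAnchors (finiteColumns_of_mem_setRT hT) c)).2
      fun a => ?_
  rw [mem_colAnchors_iff_anchor (finiteColumns_rhoHatInv hT) (posEntries_rhoHatInv hT),
    (insertColumn_spec hT c).2.1]
  simp_rw [anchor_rhoHatInv]

/-- The strict drop in the count is read off from `T` and transported along the permutations of the
two columns. Pigeonhole then gives a row counted in column `c` only, which is a host. -/
theorem exists_canHost_of_mem_colFree (hT : T ∈ SetRT μ) {c α : ℕ} (hα : α ∈ colFree T c) :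
    ∃ r, CanHost stdBasement (insertAnchors T) r c α := by
  obtain ⟨i, hi⟩ := (mem_colFree (finiteColumns_of_mem_setRT hT)).1 hα
  rw [mem_free] at hi
  have h1 := anchorCount_succ_lt (finiteColumns_of_mem_setRT hT)
    (fun r => anchor_succ_le_anchor_of_mem_setRT hT r c)
    (anchor_succ_le_of_mem_setRT hT hi.1) hi.2
  rw [← anchorCount_eq_of_perm (colAnchors_rhoHatInv_perm hT c),
    ← anchorCount_eq_of_perm (colAnchors_rhoHatInv_perm hT (c + 1)),
    ← card_rowsAbove, ← card_rowsAbove] at h1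
  obtain ⟨r, hr, hr'⟩ := Finset.exists_mem_notMem_of_card_lt_card h1
  rw [mem_rowsAbove (finiteColumns_rhoHatInv hT), anchor_rhoHatInv] at hr hr'
  exact ⟨r, (canHost_insertAnchors_iff (insertColumn_succ_le hT)).2 ⟨not_lt.1 hr', hr⟩⟩

open Classical in
theorem colFree_rhoHatInv (hT : T ∈ SetRT μ) (c : ℕ) :
    colFree (rhoHatInv T) c = colFree T c := by
  ext α
  rw [mem_colFree (finiteColumns_rhoHatInv hT)]
  simp_rw [mem_free_rhoHatInv]
  constructor
  · rintro ⟨r, h⟩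
    exact h.1
  · intro h
    have hex := exists_canHost_of_mem_colFree hT h
    exact ⟨Nat.find hex, h, Nat.find_spec hex, fun r' hr' => Nat.find_min hex hr'⟩

theorem rhoHat_rhoHatInv (hT : T ∈ SetRT μ) : rhoHat (rhoHatInv T) = T := by
  have hs : ∀ c, sortedAnchors (rhoHatInv T) c = colAnchors T c := by
    intro c
    refine List.Perm.eq_of_pairwise' (pairwise_ge_sortedAnchors _ c)
      ((pairwise_gt_colAnchors_of_mem_setRT hT c).imp fun h => le_of_lt h) ?_
    exact (sortedAnchors_perm _ c).trans (colAnchors_rhoHatInv_perm hT c)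
  funext r c
  ext x
  rw [mem_rhoHat, hs, colFree_rhoHatInv hT, length_colAnchors_of_mem_setRT hT,
    colAnchors_getD_of_mem_setRT hT, colAnchors_getD_of_mem_setRT hT,
    ← mem_free_iff_of_mem_setRT hT, ← nonempty_iff_of_mem_setRT hT,
    mem_iff_eq_anchor_or_mem_free (F := T), and_or_left]
  refine or_congr Iff.rfl ⟨fun h => h.2, fun h => ⟨nonempty_of_mem_free h, h⟩⟩

open Classical in
theorem exists_hasSkylineShape_rhoHatInv (hT : T ∈ SetRT μ) :
    ∃ γ : ℕ →₀ ℕ, HasSkylineShape (rhoHatInv T) γ := by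
  have hex : ∀ r, ∃ c, insertColumn T (c + 1) r = 0 := by
    intro r
    -- The first column in which `T` has no boxes.
    refine ⟨μ.rowLen 0, ?_⟩
    by_contra hne
    have h1 : insertColumn T (μ.rowLen 0 + 1) r ∈ colAnchors T (μ.rowLen 0) :=
      ((insertColumn_spec hT _).2.1 _).2 ⟨hne, r, rfl⟩
    have h2 := List.length_pos_of_mem h1
    rw [length_colAnchors_of_mem_setRT hT, ← YoungDiagram.mem_iff_lt_colLen,
      YoungDiagram.mem_iff_lt_rowLen] at h2
    exact lt_irrefl _ h2
  have hlt : ∀ r c, c < Nat.find (hex r) ↔ insertColumn T (c + 1) r ≠ 0 := by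
    intro r c
    rw [Nat.lt_find_iff]
    refine ⟨fun h => h c le_rfl, fun h m hm h0 => h ?_⟩
    -- Rows decrease, so a row stays empty once it has ended: boxes are left-justified.
    induction c, hm using Nat.le_induction with
    | base => exact h0
    | succ c hc ih =>
      by_contra hne
      have := insertColumn_succ_le hT (c + 1) r
      exact hne (by have := ih (by omega); omega)
  obtain ⟨s, -, hs⟩ := (insertColumn_spec hT 0).2.2
  refine ⟨Finsupp.onFinset s (fun r => Nat.find (hex r)) fun r hr => ?_, fun r c => ?_⟩
  · rw [hs, ← hlt]
    exact Nat.pos_of_ne_zero hr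
  · rw [nonempty_rhoHatInv_iff, Finsupp.onFinset_apply, hlt]

theorem exists_rhoHatInv_mem_setSkyFill (hT : T ∈ SetRT μ) :
    ∃ γ : ℕ →₀ ℕ, partitionOf γ = μ ∧ rhoHatInv T ∈ SetSkyFill γ := by
  obtain ⟨γ, hsh⟩ := exists_hasSkylineShape_rhoHatInv hT
  have hpos := posEntries_rhoHatInv hT
  have hle := insertColumn_succ_le hT
  have hrow : RowsWeaklyDecreasing stdBasement (rhoHatInv T) := by
    intro r k x hx y hy
    have hy' := le_anchor (F := rhoHatInv T) (c := k) hy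
    rw [anchor_rhoHatInv] at hy'
    refine hy'.trans ?_
    cases k with
    | zero =>
      rw [Finset.mem_singleton.1 hx]
      exact hle 0 r
    | succ k =>
      rcases mem_rhoHatInv.1 hx with h | h
      · rw [(mem_insertAnchors.1 h).2]
        exact hle (k + 1) r
      · exact ((canHost_insertAnchors_iff hle).1 h.2.1).1
  have hanchor : ∀ k, (fun r => anchorB stdBasement (rhoHatInv T) r k) = insertColumn T k := by
    intro k
    funext r
    cases k with
    | zero => rw [anchorB_zero, insertColumn]
    | succ k => rw [anchorB_succ, anchor_rhoHatInv]
  refine ⟨γ, partitionOf_eq_iff.2 fun c => ?_, hsh, hpos, columnsDistinct_rhoHatInv hT, hrow,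
    TriplesInversion.of_isGreedy hsh hpos fun k => ?_, fun r c α hα r' hr' hcan => ?_⟩
  · rw [← hsh.length_colAnchors, (colAnchors_rhoHatInv_perm hT c).length_eq,
      length_colAnchors_of_mem_setRT hT]
  · rw [hanchor, hanchor]
    exact (insertColumn_spec hT k).1
  -- Adding the free entries leaves the anchors, hence the possible hosts, unchanged.
  · refine (mem_free_rhoHatInv.1 hα).2.2 r' hr' ?_
    rwa [canHost_insertAnchors_iff hle, ← anchor_rhoHatInv, ← anchor_rhoHatInv,
      ← hrow.canHost_iff]

end SetRT

end SetSkyline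

theorem mainTheorem2 (μ : YoungDiagram) :
    Set.BijOn SetSkyline.rhoHat
      (⋃ γ ∈ {γ : ℕ →₀ ℕ | SetSkyline.partitionOf γ = μ}, SetSkyline.SetSkyFill γ)
      (SetSkyline.SetRT μ) ∧
    Set.BijOn SetSkyline.rhoHatInv
      (SetSkyline.SetRT μ)
      (⋃ γ ∈ {γ : ℕ →₀ ℕ | SetSkyline.partitionOf γ = μ}, SetSkyline.SetSkyFill γ) ∧
    Set.InvOn SetSkyline.rhoHatInv SetSkyline.rhoHat
      (⋃ γ ∈ {γ : ℕ →₀ ℕ | SetSkyline.partitionOf γ = μ}, SetSkyline.SetSkyFill γ)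
      (SetSkyline.SetRT μ) ∧
    (∀ F ∈ ⋃ γ ∈ {γ : ℕ →₀ ℕ | SetSkyline.partitionOf γ = μ}, SetSkyline.SetSkyFill γ, ∀ c : ℕ,
      SetSkyline.colAnchors (SetSkyline.rhoHat F) c = SetSkyline.sortedAnchors F c ∧
      SetSkyline.colFree (SetSkyline.rhoHat F) c = SetSkyline.colFree F c) ∧
    (∀ T ∈ SetSkyline.SetRT μ, ∀ c : ℕ,
      (SetSkyline.colAnchors (SetSkyline.rhoHatInv T) c).Perm (SetSkyline.colAnchors T c) ∧
      SetSkyline.colFree (SetSkyline.rhoHatInv T) c = SetSkyline.colFree T c) := by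

  have hD : ∀ F, (F ∈ ⋃ γ ∈ {γ : ℕ →₀ ℕ | SetSkyline.partitionOf γ = μ},
      SetSkyline.SetSkyFill γ) ↔
      ∃ γ : ℕ →₀ ℕ, SetSkyline.partitionOf γ = μ ∧ F ∈ SetSkyline.SetSkyFill γ := by
    intro F
    simp only [Set.mem_iUnion, exists_prop]
    rfl
  have hmaps : Set.MapsTo SetSkyline.rhoHat
      (⋃ γ ∈ {γ : ℕ →₀ ℕ | SetSkyline.partitionOf γ = μ}, SetSkyline.SetSkyFill γ)
      (SetSkyline.SetRT μ) := by
    intro F hF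
    obtain ⟨γ, rfl, h⟩ := (hD F).1 hF
    exact SetSkyline.rhoHat_mem_setRT h
  have hmaps' : Set.MapsTo SetSkyline.rhoHatInv (SetSkyline.SetRT μ)
      (⋃ γ ∈ {γ : ℕ →₀ ℕ | SetSkyline.partitionOf γ = μ}, SetSkyline.SetSkyFill γ) :=
    fun T hT => (hD _).2 (SetSkyline.exists_rhoHatInv_mem_setSkyFill hT)
  have hinv : Set.InvOn SetSkyline.rhoHatInv SetSkyline.rhoHat
      (⋃ γ ∈ {γ : ℕ →₀ ℕ | SetSkyline.partitionOf γ = μ}, SetSkyline.SetSkyFill γ)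
      (SetSkyline.SetRT μ) := by
    refine ⟨fun F hF => ?_, fun T hT => SetSkyline.rhoHat_rhoHatInv hT⟩
    obtain ⟨γ, -, h⟩ := (hD F).1 hF
    exact SetSkyline.rhoHatInv_rhoHat h
  refine ⟨hinv.bijOn hmaps hmaps', hinv.symm.bijOn hmaps' hmaps, hinv, fun F hF c => ?_,
    fun T hT c => ⟨SetSkyline.colAnchors_rhoHatInv_perm hT c, SetSkyline.colFree_rhoHatInv hT c⟩⟩
  obtain ⟨γ, -, h⟩ := (hD F).1 hF
  exact ⟨SetSkyline.colAnchors_rhoHat F c,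
    SetSkyline.colFree_rhoHat h.1.finiteColumns h.2.1 h.2.2.1 c⟩
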